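/- Setting. Let $\mathcal A$ be a finite non-empty set of arms, and let $\mathcal M$ (meta-parameters) and $\Theta$ (problem instances) be standard Borel spaces. For $a\in\mathcal A$, $\theta\in\Theta$ let $p_a(\cdot;\theta)$ be a probability distribution on $\mathbb R$ with mean $r(a;\theta)$, let $P(\cdot;\mu)$, $\mu\in\mathcal M$, be the task prior (a distribution on $\Theta$), and let $Q$ be the meta-prior (a distribution on $\mathcal M$). First $\mu_*\sim Q$; given $\mu_*$, the instances $\theta_{1,*},\dots,\theta_{m,*}$ are drawn i.i.d. from $P(\cdot;\mu_*)$. An agent interacts with the tasks $s=1,\dots,m$ one after another, for $n$ rounds each. In round $t$ of task $s$ it pulls an arm $A_{s,t}$, chosen (possibly at random) from the history, i.e. conditionally independent of $(\mu_*,\theta_{1,*},\dots,\theta_{m,*})$ given the history, and observes a reward $Y_{s,t}$ which, given everything so far, has distribution $p_{A_{s,t}}(\cdot;\theta_{s,*})$. Write $H_s=(A_{s,t},Y_{s,t})_{t=1}^n$, $H_{1:s}=(H_1,\dots,H_s)$, and let $H_{1:s,t}$ consist of $H_{1:s-1}$ and $(A_{s,\ell},Y_{s,\ell})_{\ell=1}^{t-1}$;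 let $\mathbb E_{s,t}[\cdot]=\mathbb E[\cdot\mid H_{1:s,t}]$. The gap is $\Delta_{s,t}=\max_{a}r(a;\theta_{s,*})-r(A_{s,t};\theta_{s,*})\ge 0$, and the Bayes regret is $R(m,n)=\mathbb E[R(m,n;\mu_*)]$, where $R(m,n;\mu_*)=\sum_{s=1}^m\mathbb E[\sum_{t=1}^n\Delta_{s,t}\mid\mu_*]$. With $D$ the relative entropy, let $I(X;Y)=D(P(X,Y)\,\|\,P(X)P(Y))$, $\hat I(X;Y\mid Z)=D(P(X,Y\mid Z)\,\|\,P(X\mid Z)P(Y\mid Z))$ (a random variable), $I(X;Y\mid Z)=\mathbb E[\hat I(X;Y\mid Z)]$, and $I_{s,t}(X;Y)=\hat I(X;Y\mid H_{1:s,t})$. All expectations and informations take values in $[0,\infty]$, with $0\cdot\infty=0$. Lemma. Let $\Gamma_{s,t},\epsilon_{s,t}\ge 0$ be (possibly history-dependent) random variables such that, for all $s\in[m]$ and $t\in[n]$, almost surely $$\mathbb E_{s,t}[\Delta_{s,t}]\le\Gamma_{s,t}\sqrt{I_{s,t}(\theta_{s,*};A_{s,t},Y_{s,t})}+\epsilon_{s,t},$$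 and let $\Gamma_1,\dots,\Gamma_m,\Gamma\ge0$ be constants such that $\Gamma_{s,t}\le\Gamma_s\le\Gamma$ almost surely for all $s\in[m]$, $t\in[n]$. Then $$R(m,n)\le\Gamma\sqrt{mn\,I(\mu_*;H_{1:m})}+\sum_{s=1}^m\Gamma_s\sqrt{n\,I(\theta_{s,*};H_s\mid\mu_*,H_{1:s-1})}+\sum_{s=1}^m\sum_{t=1}^n\mathbb E[\epsilon_{s,t}].$$ -/

import Mathlib

open MeasureTheory ProbabilityTheory InformationTheory
open scoped ENNReal NNReal

/-! ### Mutual information -/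

section Information

variable {Ω α β γ : Type*} [MeasurableSpace Ω] [MeasurableSpace α] [MeasurableSpace β]
  [MeasurableSpace γ]

/-- Mutual information `I(X; Y) = D(P(X, Y) ‖ P(X) P(Y))`, with values in `[0, ∞]`. -/
noncomputable def mutualInfo (P : Measure Ω) (X : Ω → α) (Y : Ω → β) : ℝ≥0∞ :=
  klDiv (P.map (fun ω => (X ω, Y ω))) ((P.map X).prod (P.map Y))

/-- Random conditional mutual information `Î(X; Y | Z) = D(P(X, Y | Z) ‖ P(X | Z) P(Y | Z))`,
a `Z`-measurable random variable with values in `[0, ∞]`. -/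
noncomputable def randCondMutualInfo [StandardBorelSpace α] [Nonempty α] [StandardBorelSpace β]
    [Nonempty β] (P : Measure Ω) [IsFiniteMeasure P] (X : Ω → α) (Y : Ω → β) (Z : Ω → γ)
    (ω : Ω) : ℝ≥0∞ :=
  klDiv (condDistrib (fun ω' => (X ω', Y ω')) Z P (Z ω))
    ((condDistrib X Z P (Z ω)).prod (condDistrib Y Z P (Z ω)))

/-- Conditional mutual information `I(X; Y | Z) = E[Î(X; Y | Z)]`. -/
noncomputable def condMutualInfo [StandardBorelSpace α] [Nonempty α] [StandardBorelSpace β]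
    [Nonempty β] (P : Measure Ω) [IsFiniteMeasure P] (X : Ω → α) (Y : Ω → β) (Z : Ω → γ) :
    ℝ≥0∞ :=
  ∫⁻ ω, randCondMutualInfo P X Y Z ω ∂P

end Information

/-! ### The environment -/

/-- A hierarchical Bayesian bandit environment with meta-parameters in `M`, problem instances in
`Θ` and arms in `𝒜`. -/
structure BanditEnv (M Θ 𝒜 : Type*) [MeasurableSpace M] [MeasurableSpace Θ]
    [MeasurableSpace 𝒜] where
  /-- the meta-prior `Q` -/
  metaPrior : Measure M
  isProbabilityMeasure_metaPrior : IsProbabilityMeasure metaPrior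
  /-- the task prior `P(· ; μ)` -/
  taskPrior : Kernel M Θ
  isMarkovKernel_taskPrior : IsMarkovKernel taskPrior
  /-- the reward distribution `p_a(· ; θ)` -/
  rewardLaw : Kernel (𝒜 × Θ) ℝ
  isMarkovKernel_rewardLaw : IsMarkovKernel rewardLaw
  /-- reward distributions have a mean -/
  integrable_reward : ∀ a θ, Integrable (fun y : ℝ => y) (rewardLaw (a, θ))

namespace BanditEnv

variable {M Θ 𝒜 : Type*} [MeasurableSpace M] [MeasurableSpace Θ] [MeasurableSpace 𝒜]

/-- The mean reward `r(a; θ)`. -/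
noncomputable def meanReward (E : BanditEnv M Θ 𝒜) (a : 𝒜) (θ : Θ) : ℝ :=
  ∫ y, y ∂(E.rewardLaw (a, θ))

/-- An optimal arm `argmax_a r(a; θ)`. -/
noncomputable def optArm [Finite 𝒜] [Nonempty 𝒜] (E : BanditEnv M Θ 𝒜) (θ : Θ) : 𝒜 :=
  Classical.choose (Finite.exists_max (fun a => E.meanReward a θ))

theorem meanReward_le_optArm [Finite 𝒜] [Nonempty 𝒜] (E : BanditEnv M Θ 𝒜) (a : 𝒜) (θ : Θ) :
    E.meanReward a θ ≤ E.meanReward (E.optArm θ) θ :=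
  Classical.choose_spec (Finite.exists_max (fun a => E.meanReward a θ)) a

end BanditEnv

/-! ### The interaction, its history and its regret

Tasks and rounds are numbered from `0`: tasks `s < m`, rounds `t < n`. Variables with larger
indices play no role. -/

/-- The random variables of an interaction. -/
structure BanditRun (Ω M Θ 𝒜 : Type*) [MeasurableSpace Ω] [MeasurableSpace M]
    [MeasurableSpace Θ] [MeasurableSpace 𝒜] where
  /-- the meta-parameter `μ_*` -/
  metaParam : Ω → M
  measurable_metaParam : Measurable metaParam
  /-- the problem instance `θ_{s,*}` -/
  inst : ℕ → Ω → Θ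
  measurable_inst : ∀ s, Measurable (inst s)
  /-- the pulled arm `A_{s,t}` -/
  arm : ℕ → ℕ → Ω → 𝒜
  measurable_arm : ∀ s t, Measurable (arm s t)
  /-- the observed reward `Y_{s,t}` of the pulled arm -/
  reward : ℕ → ℕ → Ω → ℝ
  measurable_reward : ∀ s t, Measurable (reward s t)

namespace BanditRun

variable {Ω M Θ 𝒜 : Type*} [MeasurableSpace Ω] [MeasurableSpace M] [MeasurableSpace Θ]
  [MeasurableSpace 𝒜]

/-- The observation `(A_{s,t}, Y_{s,t})`. -/
def obs (R : BanditRun Ω M Θ 𝒜) (s t : ℕ) (ω : Ω) : 𝒜 × ℝ := (R.arm s t ω, R.reward s t ω)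

/-- The observations in the first `t` rounds of task `s`. With `t = n` this is `H_s`. -/
def taskHist (R : BanditRun Ω M Θ 𝒜) (s t : ℕ) (ω : Ω) : Fin t → 𝒜 × ℝ := fun j => R.obs s j ω

/-- All observations in the first `s` tasks, of `n` rounds each. With `s = m` this is
`H_{1:m}`. -/
def pastHist (R : BanditRun Ω M Θ 𝒜) (n s : ℕ) (ω : Ω) : Fin s → Fin n → 𝒜 × ℝ :=
  fun i => R.taskHist i n ω

/-- The history available before round `t` of task `s`: all observations of the earlier tasks and
those of the earlier rounds of task `s`. -/
def hist (R : BanditRun Ω M Θ 𝒜) (n s t : ℕ) (ω : Ω) :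
    (Fin s → Fin n → 𝒜 × ℝ) × (Fin t → 𝒜 × ℝ) :=
  (R.pastHist n s ω, R.taskHist s t ω)

/-- The vector of the problem instances of the first `m` tasks. -/
def insts (R : BanditRun Ω M Θ 𝒜) (m : ℕ) (ω : Ω) : Fin m → Θ := fun i => R.inst i ω

/-- The optimality gap `Δ_{s,t} = r(A_{s,*}; θ_{s,*}) - r(A_{s,t}; θ_{s,*})`. -/
noncomputable def gap [Finite 𝒜] [Nonempty 𝒜] (R : BanditRun Ω M Θ 𝒜) (E : BanditEnv M Θ 𝒜)
    (s t : ℕ) (ω : Ω) : ℝ :=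
  E.meanReward (E.optArm (R.inst s ω)) (R.inst s ω) - E.meanReward (R.arm s t ω) (R.inst s ω)

theorem gap_nonneg [Finite 𝒜] [Nonempty 𝒜] (R : BanditRun Ω M Θ 𝒜) (E : BanditEnv M Θ 𝒜)
    (s t : ℕ) (ω : Ω) : 0 ≤ R.gap E s t ω :=
  sub_nonneg.2 (E.meanReward_le_optArm _ _)

/-- The conditional expected gap `E_{s,t}[Δ_{s,t}]` given the history. The gap is nonnegative and
the conditional expectation is taken in `[0, ∞]`. -/
noncomputable def condGap [Finite 𝒜] [Nonempty 𝒜] (R : BanditRun Ω M Θ 𝒜)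
    (E : BanditEnv M Θ 𝒜) (P : Measure Ω) (n s t : ℕ) : Ω → ℝ≥0∞ :=
  P⁻[fun ω => ENNReal.ofReal (R.gap E s t ω) | MeasurableSpace.comap (R.hist n s t) inferInstance]

/-- The regret `R(m, n; μ_*) = ∑ₛ E[∑ₜ Δ_{s,t} | μ_*]`, as a random variable. -/
noncomputable def regret [Finite 𝒜] [Nonempty 𝒜] (R : BanditRun Ω M Θ 𝒜)
    (E : BanditEnv M Θ 𝒜) (P : Measure Ω) (m n : ℕ) (ω : Ω) : ℝ≥0∞ :=
  ∑ s ∈ Finset.range m,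
    (P⁻[fun ω' => ∑ t ∈ Finset.range n, ENNReal.ofReal (R.gap E s t ω') |
      MeasurableSpace.comap R.metaParam inferInstance]) ω

/-- The Bayes regret `R(m, n) = E[R(m, n; μ_*)]`. -/
noncomputable def bayesRegret [Finite 𝒜] [Nonempty 𝒜] (R : BanditRun Ω M Θ 𝒜)
    (E : BanditEnv M Θ 𝒜) (P : Measure Ω) (m n : ℕ) : ℝ≥0∞ :=
  ∫⁻ ω, R.regret E P m n ω ∂P

/-- Under `P`, the run is an interaction of some agent with the environment `E` over `m` tasks of
`n` rounds: `μ_* ∼ Q`; given `μ_*`, the instances are i.i.d. from `P(· ; μ_*)`; the agent chooses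
its arms from the history, possibly with randomization of its own; and the observed reward is a
fresh draw from the reward distribution of the pulled arm. -/
structure IsInteraction [StandardBorelSpace Θ] [Nonempty Θ] [StandardBorelSpace 𝒜] [Nonempty 𝒜]
    (R : BanditRun Ω M Θ 𝒜) (E : BanditEnv M Θ 𝒜) (P : Measure Ω) [IsFiniteMeasure P]
    (m n : ℕ) : Prop where
  metaParam_law : P.map R.metaParam = E.metaPrior
  insts_law : ∀ᵐ ω ∂P, condDistrib (R.insts m) R.metaParam P (R.metaParam ω) =
    Measure.pi (fun _ : Fin m => E.taskPrior (R.metaParam ω))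
  arm_law : ∀ s < m, ∀ t < n, ∀ᵐ ω ∂P,
    condDistrib (R.arm s t) (fun ω' => (R.metaParam ω', R.insts m ω', R.hist n s t ω')) P
        (R.metaParam ω, R.insts m ω, R.hist n s t ω) =
      condDistrib (R.arm s t) (R.hist n s t) P (R.hist n s t ω)
  reward_law : ∀ s < m, ∀ t < n, ∀ᵐ ω ∂P,
    condDistrib (R.reward s t)
        (fun ω' => (R.metaParam ω', R.insts m ω', R.hist n s t ω', R.arm s t ω')) P
        (R.metaParam ω, R.insts m ω, R.hist n s t ω, R.arm s t ω) =
      E.rewardLaw (R.arm s t ω, R.inst s ω)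

end BanditRun

/-! ### Relative entropy of measures composed with kernels. -/

section KullbackLeibler

variable {α β γ : Type*} [MeasurableSpace α] [MeasurableSpace β] [MeasurableSpace γ]

/-! Integrating the per-round hypothesis and applying Jensen to the square root bounds the expected
gap by `Γs s` times the root of `I(θ_s; A, Y | H)`, plus the mean of `ε` (`lintegral_gap_le`). What
a round reveals about `θ_s` is at most what it reveals about `(μ_*, θ_s)`, which splits into
information on `μ_*` plus information on `θ_s` given `μ_*` (`condMutualInfo_le_add`). The root is
subadditive, so the two parts separate. Cauchy–Schwarz over all `mn` rounds for the first, and over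
the `n` rounds of each task for the second, moves the sums under the root, where the chain rule
bounds them by the information in whole histories (`sum_condMutualInfo_hist_le`,
`sum_condMutualInfo_inst_le`).

The chain rule comes from that of relative entropy, once conditional mutual information is written
as one divergence between joint laws. All of this takes place in `[0, ∞]`, without finiteness
assumptions on the information. -/

theorem klDiv_map_eq_of_leftInverse (μ ν : Measure α) [IsFiniteMeasure μ] [IsFiniteMeasure ν]
    {f : α → β} {g : β → α} (hf : Measurable f) (hg : Measurable g)
    (h : Function.LeftInverse g f) : klDiv (μ.map f) (ν.map f) = klDiv μ ν := by
  refine le_antisymm (klDiv_map_le μ ν hf) ?_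
  have := klDiv_map_le (μ.map f) (ν.map f) hg
  rwa [Measure.map_map hg hf, Measure.map_map hg hf, h.comp_eq_id, Measure.map_id,
    Measure.map_id] at this

theorem compProd_prod_map_assoc_symm (μ : Measure γ) [IsFiniteMeasure μ] (κ : Kernel γ α)
    (η : Kernel γ β) [IsFiniteKernel κ] [IsFiniteKernel η] :
    (μ ⊗ₘ (κ ×ₖ η)).map (fun p => ((p.1, p.2.1), p.2.2)) =
      (μ ⊗ₘ κ) ⊗ₘ (η.comap Prod.fst measurable_fst) := by
  refine Measure.ext_of_lintegral _ fun f hf => ?_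
  rw [lintegral_map hf (by fun_prop), Measure.lintegral_compProd (by fun_prop),
    Measure.lintegral_compProd hf, Measure.lintegral_compProd ?_]
  · refine lintegral_congr fun z => ?_
    rw [Kernel.prod_apply, lintegral_prod _ (by fun_prop)]
    rfl
  · exact Measurable.lintegral_kernel_prod_right' hf

variable [MeasurableSpace.CountableOrCountablyGenerated α β]

theorem measurable_klDiv_kernel (κ η : Kernel α β) [IsFiniteKernel κ] [IsFiniteKernel η] :
    Measurable fun a => klDiv (κ a) (η a) := by
  classical
  have h : ∀ a, klDiv (κ a) (η a) = if κ a ≪ η a then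
      ∫⁻ x, ENNReal.ofReal (klFun (κ.rnDeriv η a x).toReal) ∂(η a) else ∞ := by
    intro a
    rw [klDiv_eq_lintegral_klFun]
    congr 1
    refine lintegral_congr_ae ?_
    filter_upwards [κ.rnDeriv_eq_rnDeriv_measure (η := η) (a := a)] with x hx
    rw [hx]
  simp_rw [h]
  refine Measurable.ite (Kernel.measurableSet_absolutelyContinuous κ η) ?_ measurable_const
  refine Measurable.lintegral_kernel_prod_right' (f := fun p : α × β =>
    ENNReal.ofReal (klFun (κ.rnDeriv η p.1 p.2).toReal)) ?_
  have := Kernel.measurable_rnDeriv κ η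
  fun_prop

/-- The kernel derivative `κ.rnDeriv η` is also the density of the joint measures. If absolute
continuity fails on a non-null set of fibres, both sides are infinite. -/
theorem klDiv_compProd_right (μ : Measure α) [IsFiniteMeasure μ] (κ η : Kernel α β)
    [IsFiniteKernel κ] [IsFiniteKernel η] :
    klDiv (μ ⊗ₘ κ) (μ ⊗ₘ η) = ∫⁻ a, klDiv (κ a) (η a) ∂μ := by
  have hm := Kernel.measurable_rnDeriv κ η
  by_cases hac : ∀ᵐ a ∂μ, κ a ≪ η a
  · have hac' := Measure.absolutelyContinuous_compProd_right_iff.2 hac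
    have hd : μ ⊗ₘ κ = (μ ⊗ₘ η).withDensity fun p => κ.rnDeriv η p.1 p.2 := by
      ext s hs
      rw [withDensity_apply _ hs, Measure.compProd_apply hs, ← lintegral_indicator hs,
        Measure.lintegral_compProd (hm.indicator hs)]
      refine lintegral_congr_ae ?_
      filter_upwards [hac] with a ha
      rw [← Kernel.setLIntegral_rnDeriv ha (measurable_prodMk_left hs),
        ← lintegral_indicator (measurable_prodMk_left hs)]
      rfl
    have hr : (μ ⊗ₘ κ).rnDeriv (μ ⊗ₘ η) =ᵐ[μ ⊗ₘ η] fun p => κ.rnDeriv η p.1 p.2 := by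
      rw [hd]
      exact Measure.rnDeriv_withDensity _ hm
    rw [klDiv_eq_lintegral_klFun_of_ac hac',
      lintegral_congr_ae (g := fun p => ENNReal.ofReal (klFun (κ.rnDeriv η p.1 p.2).toReal))
        (by filter_upwards [hr] with p hp; rw [hp]),
      Measure.lintegral_compProd (by fun_prop)]
    refine lintegral_congr_ae ?_
    filter_upwards [hac] with a ha
    rw [klDiv_eq_lintegral_klFun_of_ac ha]
    refine lintegral_congr_ae ?_
    filter_upwards [κ.rnDeriv_eq_rnDeriv_measure (η := η) (a := a)] with x hx
    rw [hx]
  · rw [klDiv_of_not_ac (mt Measure.absolutelyContinuous_compProd_right_iff.1 hac)]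
    by_contra hne
    refine hac ?_
    filter_upwards [ae_lt_top (measurable_klDiv_kernel κ η) (Ne.symm hne)] with a ha
    exact (klDiv_ne_top_iff.1 ha.ne).1

end KullbackLeibler

/-! ### Regular conditional distributions. -/

section CondDistrib

variable {Ω α γ γ' : Type*} [MeasurableSpace Ω] [MeasurableSpace α] [StandardBorelSpace α]
  [Nonempty α] [MeasurableSpace γ] [MeasurableSpace γ']

/-- `Z` and `e ∘ Z` carry the same information, so the conditioning variable may be re-encoded, for
instance by permuting its coordinates. -/
theorem condDistrib_ae_eq_comap_of_leftInverse (P : Measure Ω) [IsFiniteMeasure P] {X : Ω → α}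
    {Z : Ω → γ} (hX : Measurable X) (hZ : Measurable Z) {e : γ → γ'} {e' : γ' → γ}
    (he : Measurable e) (he' : Measurable e') (h : ∀ ω, e' (e (Z ω)) = Z ω) :
    ∀ᵐ ω ∂P, condDistrib X Z P (Z ω) = condDistrib X (fun ω' => e (Z ω')) P (e (Z ω)) := by
  refine ae_of_ae_map hZ.aemeasurable (f := Z)
    (p := fun z => condDistrib X Z P z = condDistrib X (fun ω' => e (Z ω')) P (e z)) ?_
  refine condDistrib_ae_eq_of_measure_eq_compProd (κ := (condDistrib X (fun ω' => e (Z ω')) P).comap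
    e he) Z hX.aemeasurable ?_
  have h1 : (P.map fun ω => e (Z ω)) ⊗ₘ condDistrib X (fun ω' => e (Z ω')) P =
      P.map fun ω => (e (Z ω), X ω) := compProd_map_condDistrib hX.aemeasurable
  refine Measure.ext_of_lintegral _ fun f hf => ?_
  have hf' : Measurable fun p : γ' × α => f (e' p.1, p.2) := by fun_prop
  have hm : Measurable fun z => ∫⁻ x, f (e' z, x) ∂condDistrib X (fun ω' => e (Z ω')) P z :=
    Measurable.lintegral_kernel_prod_right' hf'
  have hm' : Measurable fun z => ∫⁻ x, f (z, x) ∂condDistrib X (fun ω' => e (Z ω')) P (e z) :=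
    Measurable.lintegral_kernel_prod_right' (κ := (condDistrib X (fun ω' => e (Z ω')) P).comap
      e he) hf
  have h2 : ∫⁻ p, f (e' p.1, p.2) ∂((P.map fun ω => e (Z ω)) ⊗ₘ
      condDistrib X (fun ω' => e (Z ω')) P) =
      ∫⁻ p, f (e' p.1, p.2) ∂(P.map fun ω => (e (Z ω), X ω)) := by rw [h1]
  rw [Measure.lintegral_compProd hf', lintegral_map hf' (by fun_prop),
    lintegral_map hm (by fun_prop)] at h2
  rw [Measure.lintegral_compProd hf, lintegral_map hf (by fun_prop)]
  simp only [Kernel.comap_apply]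
  rw [lintegral_map hm' hZ]
  simpa only [h] using h2.symm

theorem condDistrib_const_right_apply {P : Measure Ω} [IsProbabilityMeasure P] {X : Ω → α}
    (hX : Measurable X) : condDistrib X (fun _ => ()) P () = P.map X := by
  have h : P.map (fun _ : Ω => ()) = Measure.dirac () := by simp
  rw [← condDistrib_comp_map (μ := P) (X := fun _ => ()) (by fun_prop) hX.aemeasurable, h,
    Measure.dirac_bind (Kernel.measurable _)]

end CondDistrib

/-! ### Conditional mutual information: chain rules and data processing. -/

section Information

variable {Ω α β γ α' β' γ' : Type*} [MeasurableSpace Ω]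
  [MeasurableSpace α] [StandardBorelSpace α] [Nonempty α]
  [MeasurableSpace β] [StandardBorelSpace β] [Nonempty β]
  [MeasurableSpace α'] [StandardBorelSpace α'] [Nonempty α']
  [MeasurableSpace β'] [StandardBorelSpace β'] [Nonempty β']
  [MeasurableSpace γ] [MeasurableSpace γ']
  {P : Measure Ω} [IsProbabilityMeasure P] {X : Ω → α} {Y : Ω → β} {X' : Ω → α'} {Y' : Ω → β'}
  {Z : Ω → γ}

theorem measurable_randCondMutualInfo (P : Measure Ω) [IsFiniteMeasure P] (X : Ω → α) (Y : Ω → β)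
    (hZ : Measurable Z) : Measurable (randCondMutualInfo P X Y Z) := by
  have := measurable_klDiv_kernel (condDistrib (fun ω' => (X ω', Y ω')) Z P)
    (condDistrib X Z P ×ₖ condDistrib Y Z P)
  simp_rw [Kernel.prod_apply] at this
  exact this.comp hZ

theorem condMutualInfo_eq_klDiv (hX : Measurable X) (hY : Measurable Y) (hZ : Measurable Z) :
    condMutualInfo P X Y Z = klDiv (P.map fun ω => (Z ω, (X ω, Y ω)))
      (P.map Z ⊗ₘ (condDistrib X Z P ×ₖ condDistrib Y Z P)) := by
  rw [← compProd_map_condDistrib (hX.prodMk hY).aemeasurable, klDiv_compProd_right,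
    lintegral_map (measurable_klDiv_kernel _ _) hZ]
  simp_rw [Kernel.prod_apply]
  rfl

/-- Under the reference law `Y` depends on `(Z, X)` through `Z` alone. This is the form to which
`klDiv_compProd_eq_add` applies. -/
theorem condMutualInfo_eq_klDiv_compProd (hX : Measurable X) (hY : Measurable Y)
    (hZ : Measurable Z) :
    condMutualInfo P X Y Z = klDiv (P.map fun ω => ((Z ω, X ω), Y ω))
      (P.map (fun ω => (Z ω, X ω)) ⊗ₘ (condDistrib Y Z P).comap Prod.fst measurable_fst) := by
  rw [condMutualInfo_eq_klDiv hX hY hZ, ← compProd_map_condDistrib hX.aemeasurable,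
    ← compProd_prod_map_assoc_symm,
    ← klDiv_map_eq_of_leftInverse (f := fun p : γ × α × β => ((p.1, p.2.1), p.2.2))
      (g := fun p => (p.1.1, p.1.2, p.2)) _ _ (by fun_prop) (by fun_prop) (fun _ => rfl),
    Measure.map_map (by fun_prop) (by fun_prop)]
  rfl

theorem condMutualInfo_comm (hX : Measurable X) (hY : Measurable Y) (hZ : Measurable Z) :
    condMutualInfo P X Y Z = condMutualInfo P Y X Z := by
  rw [condMutualInfo_eq_klDiv hX hY hZ, condMutualInfo_eq_klDiv hY hX hZ,
    ← klDiv_map_eq_of_leftInverse (f := fun p : γ × α × β => (p.1, p.2.2, p.2.1))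
      (g := fun p => (p.1, p.2.2, p.2.1)) _ _ (by fun_prop) (by fun_prop) (fun _ => rfl),
    Measure.map_map (by fun_prop) (by fun_prop)]
  congr 1
  refine Measure.ext_of_lintegral _ fun f hf => ?_
  rw [lintegral_map hf (by fun_prop), Measure.lintegral_compProd (by fun_prop),
    Measure.lintegral_compProd hf]
  refine lintegral_congr fun z => ?_
  rw [Kernel.prod_apply, Kernel.prod_apply, ← Measure.prod_swap,
    lintegral_map (by fun_prop) (by fun_prop)]
  rfl

/-- Chain rule `I((X, X'); Y | Z) = I(X; Y | Z) + I(X'; Y | Z, X)`. -/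
theorem condMutualInfo_prod_left (hX : Measurable X) (hX' : Measurable X') (hY : Measurable Y)
    (hZ : Measurable Z) :
    condMutualInfo P (fun ω => (X ω, X' ω)) Y Z =
      condMutualInfo P X Y Z + condMutualInfo P X' Y (fun ω => (Z ω, X ω)) := by
  have hZX := hZ.prodMk hX
  -- With the coordinates reordered as `(((Z, X), Y), X')`, the divergence chain rule splits off
  -- `X'`: the marginal term is `I(X; Y | Z)`, the conditional one `I(Y; X' | Z, X)`.
  rw [condMutualInfo_comm hX' hY hZX,
    condMutualInfo_eq_klDiv_compProd (hX.prodMk hX') hY hZ,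
    condMutualInfo_eq_klDiv_compProd hX hY hZ,
    condMutualInfo_eq_klDiv_compProd hY hX' hZX,
    ← compProd_map_condDistrib (X := fun ω => ((Z ω, X ω), Y ω)) hX'.aemeasurable,
    ← klDiv_compProd_eq_add, compProd_map_condDistrib hX'.aemeasurable,
    ← klDiv_map_eq_of_leftInverse
      (f := fun p : (γ × α × α') × β => (((p.1.1, p.1.2.1), p.2), p.1.2.2))
      (g := fun p => ((p.1.1.1, p.1.1.2, p.2), p.1.2)) _ _ (by fun_prop) (by fun_prop)
      (fun _ => rfl),
    Measure.map_map (by fun_prop) (by fun_prop)]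
  congr 1
  have h : P.map (fun ω => (Z ω, X ω, X' ω)) = (P.map (fun ω => (Z ω, X ω)) ⊗ₘ
      condDistrib X' (fun ω => (Z ω, X ω)) P).map (fun p => (p.1.1, p.1.2, p.2)) := by
    rw [compProd_map_condDistrib hX'.aemeasurable, Measure.map_map (by fun_prop) (by fun_prop)]
    rfl
  refine Measure.ext_of_lintegral _ fun f hf => ?_
  have hf1 : Measurable fun p : (γ × α × α') × β => f (((p.1.1, p.1.2.1), p.2), p.1.2.2) := by
    fun_prop
  have hm1 : Measurable fun q : γ × α × α' =>
      ∫⁻ y, f (((q.1, q.2.1), y), q.2.2) ∂(condDistrib Y Z P q.1) :=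
    Measurable.lintegral_kernel_prod_right' (κ := (condDistrib Y Z P).comap
      (Prod.fst : γ × α × α' → γ) measurable_fst) hf1
  have hm2 : Measurable fun q : (γ × α) × β =>
      ∫⁻ x, f (q, x) ∂(condDistrib X' (fun ω => (Z ω, X ω)) P q.1) :=
    Measurable.lintegral_kernel_prod_right' (κ := (condDistrib X' (fun ω => (Z ω, X ω)) P).comap
      (Prod.fst : (γ × α) × β → γ × α) measurable_fst) hf
  rw [lintegral_map hf (by fun_prop), Measure.lintegral_compProd hf1,
    Measure.lintegral_compProd hf, h]
  simp only [Kernel.comap_apply]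
  rw [lintegral_map hm1 (by fun_prop), Measure.lintegral_compProd
      (hm1.fun_comp (by fun_prop : Measurable fun p : (γ × α) × α' => (p.1.1, p.1.2, p.2))),
    Measure.lintegral_compProd hm2]
  refine lintegral_congr fun p => ?_
  simp only [Kernel.comap_apply]
  -- In the reference law `Y` and `X'` are independent given `(Z, X)`, so they may be drawn in
  -- either order.
  rw [lintegral_lintegral_swap]
  exact Measurable.aemeasurable (by fun_prop)

/-- Chain rule `I(X; (Y, Y') | Z) = I(X; Y | Z) + I(X; Y' | Z, Y)`. -/
theorem condMutualInfo_prod_right (hX : Measurable X) (hY : Measurable Y) (hY' : Measurable Y')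
    (hZ : Measurable Z) :
    condMutualInfo P X (fun ω => (Y ω, Y' ω)) Z =
      condMutualInfo P X Y Z + condMutualInfo P X Y' (fun ω => (Z ω, Y ω)) := by
  rw [condMutualInfo_comm hX (hY.prodMk hY') hZ, condMutualInfo_prod_left hY hY' hX hZ,
    condMutualInfo_comm hY hX hZ, condMutualInfo_comm hY' hX (hZ.prodMk hY)]

/-- Data processing for conditional mutual information. -/
theorem condMutualInfo_comp_right_le (hX : Measurable X) (hY : Measurable Y) (hZ : Measurable Z)
    {f : β → β'} (hf : Measurable f) :
    condMutualInfo P X (fun ω => f (Y ω)) Z ≤ condMutualInfo P X Y Z := by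
  -- For almost every value of `Z`, this is data processing for `klDiv` under the map `id × f`.
  refine lintegral_mono_ae ?_
  have hg : Measurable fun p : α × β => (p.1, f p.2) := by fun_prop
  have h1 := ae_of_ae_map hZ.aemeasurable
    (condDistrib_comp (μ := P) Z (hX.prodMk hY).aemeasurable hg)
  have h2 := ae_of_ae_map hZ.aemeasurable (condDistrib_comp (μ := P) Z hY.aemeasurable hf)
  filter_upwards [h1, h2] with ω h1 h2
  rw [Kernel.map_apply _ hg] at h1
  rw [Kernel.map_apply _ hf] at h2
  change klDiv (condDistrib ((fun p : α × β => (p.1, f p.2)) ∘ fun ω' => (X ω', Y ω')) Z P (Z ω))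
    ((condDistrib X Z P (Z ω)).prod (condDistrib (f ∘ Y) Z P (Z ω))) ≤ _
  have h3 : (condDistrib X Z P (Z ω)).prod ((condDistrib Y Z P (Z ω)).map f) =
      ((condDistrib X Z P (Z ω)).prod (condDistrib Y Z P (Z ω))).map (fun p => (p.1, f p.2)) := by
    have := Measure.map_prod_map (condDistrib X Z P (Z ω)) (condDistrib Y Z P (Z ω))
      measurable_id hf
    rwa [Measure.map_id] at this
  rw [h1, h2, h3]
  exact klDiv_map_le _ _ hg

theorem condMutualInfo_congr_cond (hX : Measurable X) (hY : Measurable Y) (hZ : Measurable Z)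
    {e : γ → γ'} {e' : γ' → γ} (he : Measurable e) (he' : Measurable e')
    (h : ∀ ω, e' (e (Z ω)) = Z ω) :
    condMutualInfo P X Y (fun ω => e (Z ω)) = condMutualInfo P X Y Z := by
  refine lintegral_congr_ae ?_
  filter_upwards [condDistrib_ae_eq_comap_of_leftInverse P (hX.prodMk hY) hZ he he' h,
    condDistrib_ae_eq_comap_of_leftInverse P hX hZ he he' h,
    condDistrib_ae_eq_comap_of_leftInverse P hY hZ he he' h] with ω h1 h2 h3
  rw [randCondMutualInfo, randCondMutualInfo, h1, h2, h3]

/-- `I(X; Y | Z) ≤ I(X'; Y | Z) + I(X; Y | Z, X')`. -/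
theorem condMutualInfo_le_add (hX : Measurable X) (hX' : Measurable X') (hY : Measurable Y)
    (hZ : Measurable Z) :
    condMutualInfo P X Y Z ≤
      condMutualInfo P X' Y Z + condMutualInfo P X Y (fun ω => (Z ω, X' ω)) := by
  rw [← condMutualInfo_prod_left hX' hX hY hZ, condMutualInfo_comm hX hY hZ,
    condMutualInfo_comm (hX'.prodMk hX) hY hZ]
  exact condMutualInfo_comp_right_le hY (hX'.prodMk hX) hZ measurable_snd

theorem mutualInfo_eq_condMutualInfo_unit (hX : Measurable X) (hY : Measurable Y) :
    mutualInfo P X Y = condMutualInfo P X Y (fun _ => ()) := by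
  rw [condMutualInfo]
  simp_rw [randCondMutualInfo]
  rw [condDistrib_const_right_apply hX, condDistrib_const_right_apply hY,
    condDistrib_const_right_apply (hX.prodMk hY)]
  simp [mutualInfo]

/-- Chain rule `I(X; (Y, Y')) = I(X; Y) + I(X; Y' | Y)`. -/
theorem mutualInfo_prod_right (hX : Measurable X) (hY : Measurable Y) (hY' : Measurable Y') :
    mutualInfo P X (fun ω => (Y ω, Y' ω)) = mutualInfo P X Y + condMutualInfo P X Y' Y := by
  rw [mutualInfo_eq_condMutualInfo_unit hX (hY.prodMk hY'),
    mutualInfo_eq_condMutualInfo_unit hX hY,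
    condMutualInfo_prod_right hX hY hY' measurable_const,
    condMutualInfo_congr_cond (e := fun y : β => ((), y)) (e' := Prod.snd) hX hY' hY
      (by fun_prop) (by fun_prop) (fun _ => rfl)]

/-- Data processing for mutual information. -/
theorem mutualInfo_comp_right_le (hX : Measurable X) (hY : Measurable Y) {f : β → β'}
    (hf : Measurable f) : mutualInfo P X (fun ω => f (Y ω)) ≤ mutualInfo P X Y := by
  rw [mutualInfo_eq_condMutualInfo_unit hX (hf.fun_comp hY), mutualInfo_eq_condMutualInfo_unit hX hY]
  exact condMutualInfo_comp_right_le hX hY measurable_const hf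

end Information

/-! ### Square roots and Cauchy–Schwarz against the constant `1`. -/

theorem ENNReal.rpow_half_rpow_two (x : ℝ≥0∞) : (x ^ (1 / 2 : ℝ)) ^ (2 : ℝ) = x := by
  rw [← ENNReal.rpow_mul]
  norm_num

theorem lintegral_rpow_half_le {Ω : Type*} [MeasurableSpace Ω] (P : Measure Ω)
    [IsProbabilityMeasure P] {f : Ω → ℝ≥0∞} (hf : AEMeasurable f P) :
    ∫⁻ ω, f ω ^ (1 / 2 : ℝ) ∂P ≤ (∫⁻ ω, f ω ∂P) ^ (1 / 2 : ℝ) := by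
  have h := ENNReal.lintegral_mul_le_Lp_mul_Lq P Real.HolderConjugate.two_two
    (hf.pow_const (1 / 2 : ℝ)) (aemeasurable_const (b := (1 : ℝ≥0∞)))
  simp only [ENNReal.rpow_half_rpow_two] at h
  simpa using h

theorem ENNReal.sum_rpow_half_le {ι : Type*} (s : Finset ι) (f : ι → ℝ≥0∞) :
    ∑ i ∈ s, f i ^ (1 / 2 : ℝ) ≤ (s.card * ∑ i ∈ s, f i) ^ (1 / 2 : ℝ) := by
  have h := ENNReal.inner_le_Lp_mul_Lq s (fun i => f i ^ (1 / 2 : ℝ)) (fun _ => 1)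
    Real.HolderConjugate.two_two
  rw [ENNReal.mul_rpow_of_nonneg _ _ (by norm_num), mul_comm]
  simp only [ENNReal.rpow_half_rpow_two] at h
  simpa using h

/-! ### Measurability of the mean rewards. -/

namespace BanditEnv

variable {M Θ 𝒜 : Type*} [MeasurableSpace M] [MeasurableSpace Θ] [MeasurableSpace 𝒜]

theorem measurable_meanReward (E : BanditEnv M Θ 𝒜) :
    Measurable fun p : 𝒜 × Θ => E.meanReward p.1 p.2 :=
  have := E.isMarkovKernel_rewardLaw
  (StronglyMeasurable.integral_kernel (κ := E.rewardLaw) (f := fun y : ℝ => y)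
    stronglyMeasurable_id).measurable

/-- The selection `optArm` is made by choice and need not be measurable, but its value is a supremum
of finitely many measurable functions. -/
theorem measurable_meanReward_optArm [Finite 𝒜] [Nonempty 𝒜] (E : BanditEnv M Θ 𝒜) :
    Measurable fun θ => E.meanReward (E.optArm θ) θ := by
  have h : (fun θ => E.meanReward (E.optArm θ) θ) = fun θ => ⨆ a, E.meanReward a θ := by
    funext θ
    exact le_antisymm (le_ciSup (f := fun a => E.meanReward a θ) (Set.finite_range _).bddAbove _)
      (ciSup_le fun a => E.meanReward_le_optArm a θ)
  rw [h]
  exact Measurable.iSup fun a => E.measurable_meanReward.comp measurable_prodMk_left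

end BanditEnv

/-! ### Information collected over rounds and tasks, and the gap of one round. -/

namespace BanditRun

variable {Ω M Θ 𝒜 : Type*} [MeasurableSpace Ω] [MeasurableSpace M] [MeasurableSpace Θ]
  [MeasurableSpace 𝒜] (R : BanditRun Ω M Θ 𝒜)

theorem measurable_obs (s t : ℕ) : Measurable (R.obs s t) :=
  (R.measurable_arm s t).prodMk (R.measurable_reward s t)

theorem measurable_taskHist (s t : ℕ) : Measurable (R.taskHist s t) :=
  measurable_pi_lambda _ fun j => R.measurable_obs s j

theorem measurable_pastHist (n s : ℕ) : Measurable (R.pastHist n s) :=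
  measurable_pi_lambda _ fun i => R.measurable_taskHist i n

theorem measurable_hist (n s t : ℕ) : Measurable (R.hist n s t) :=
  (R.measurable_pastHist n s).prodMk (R.measurable_taskHist s t)

theorem measurable_gap [Finite 𝒜] [Nonempty 𝒜] (E : BanditEnv M Θ 𝒜) (s t : ℕ) :
    Measurable (R.gap E s t) :=
  (E.measurable_meanReward_optArm.comp (R.measurable_inst s)).sub
    (E.measurable_meanReward.comp ((R.measurable_arm s t).prodMk (R.measurable_inst s)))

theorem bayesRegret_eq_sum [Finite 𝒜] [Nonempty 𝒜] (E : BanditEnv M Θ 𝒜) (P : Measure Ω)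
    [IsFiniteMeasure P] (m n : ℕ) :
    R.bayesRegret E P m n = ∑ s ∈ Finset.range m, ∑ t ∈ Finset.range n,
      ∫⁻ ω, ENNReal.ofReal (R.gap E s t ω) ∂P := by
  simp only [bayesRegret, regret]
  rw [lintegral_finsetSum _ fun s _ => measurable_condLExp' _ _ _]
  refine Finset.sum_congr rfl fun s _ => ?_
  rw [lintegral_condLExp R.measurable_metaParam.comap_le,
    lintegral_finsetSum _ fun t _ => (R.measurable_gap E s t).ennreal_ofReal]

variable [StandardBorelSpace 𝒜] [Nonempty 𝒜] (P : Measure Ω) [IsProbabilityMeasure P]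

theorem sum_condMutualInfo_obs_le {α γ : Type*} [MeasurableSpace α] [StandardBorelSpace α]
    [Nonempty α] [MeasurableSpace γ] {X : Ω → α} {Z : Ω → γ} (hX : Measurable X)
    (hZ : Measurable Z) (s n : ℕ) :
    ∑ t ∈ Finset.range n, condMutualInfo P X (R.obs s t) (fun ω => (Z ω, R.taskHist s t ω)) ≤
      condMutualInfo P X (R.taskHist s n) Z := by
  induction n with
  | zero => simp
  | succ n ih =>
    rw [Finset.sum_range_succ]
    refine (add_le_add_left ih _).trans ?_
    rw [← condMutualInfo_prod_right hX (R.measurable_taskHist s n) (R.measurable_obs s n) hZ]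
    -- Splitting off the last round is a function of the longer history; an inequality suffices, so
    -- data processing replaces an equivalence.
    exact condMutualInfo_comp_right_le (f := fun h : Fin (n + 1) → 𝒜 × ℝ =>
      ((fun i : Fin n => h i.castSucc), h (Fin.last n))) hX (R.measurable_taskHist s (n + 1)) hZ
      (by fun_prop)

theorem sum_condMutualInfo_taskHist_le {α : Type*} [MeasurableSpace α] [StandardBorelSpace α]
    [Nonempty α] {X : Ω → α} (hX : Measurable X) (m n : ℕ) :
    ∑ s ∈ Finset.range m, condMutualInfo P X (R.taskHist s n) (R.pastHist n s) ≤
      mutualInfo P X (R.pastHist n m) := by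
  induction m with
  | zero => simp
  | succ m ih =>
    rw [Finset.sum_range_succ]
    refine (add_le_add_left ih _).trans ?_
    rw [← mutualInfo_prod_right hX (R.measurable_pastHist n m) (R.measurable_taskHist m n)]
    exact mutualInfo_comp_right_le (f := fun h : Fin (m + 1) → Fin n → 𝒜 × ℝ =>
      ((fun i : Fin m => h i.castSucc), h (Fin.last m))) hX (R.measurable_pastHist n (m + 1))
      (by fun_prop)

theorem sum_condMutualInfo_hist_le {α : Type*} [MeasurableSpace α] [StandardBorelSpace α]
    [Nonempty α] {X : Ω → α} (hX : Measurable X) (m n : ℕ) :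
    ∑ s ∈ Finset.range m, ∑ t ∈ Finset.range n, condMutualInfo P X (R.obs s t) (R.hist n s t) ≤
      mutualInfo P X (R.pastHist n m) :=
  (Finset.sum_le_sum fun s _ => R.sum_condMutualInfo_obs_le P hX (R.measurable_pastHist n s) s n)
    |>.trans (R.sum_condMutualInfo_taskHist_le P hX m n)

theorem sum_condMutualInfo_inst_le [StandardBorelSpace Θ] [Nonempty Θ] (s n : ℕ) :
    ∑ t ∈ Finset.range n, condMutualInfo P (R.inst s) (R.obs s t)
        (fun ω => (R.hist n s t ω, R.metaParam ω)) ≤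
      condMutualInfo P (R.inst s) (R.taskHist s n)
        (fun ω => (R.metaParam ω, R.pastHist n s ω)) := by
  refine le_trans (Finset.sum_le_sum fun t _ => le_of_eq ?_)
    (R.sum_condMutualInfo_obs_le P (R.measurable_inst s)
      (R.measurable_metaParam.prodMk (R.measurable_pastHist n s)) s n)
  exact (condMutualInfo_congr_cond
    (e := fun z : ((Fin s → Fin n → 𝒜 × ℝ) × (Fin t → 𝒜 × ℝ)) × M => ((z.2, z.1.1), z.1.2))
    (e' := fun z => ((z.1.2, z.2), z.1.1)) (R.measurable_inst s) (R.measurable_obs s t)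
    ((R.measurable_hist n s t).prodMk R.measurable_metaParam) (by fun_prop) (by fun_prop)
    (fun _ => rfl)).symm

theorem lintegral_gap_le [Finite 𝒜] [StandardBorelSpace Θ] [Nonempty Θ] {E : BanditEnv M Θ 𝒜}
    {n s t : ℕ} {G ε : Ω → ℝ≥0} (hε : Measurable ε)
    (hgap : ∀ᵐ ω ∂P, R.condGap E P n s t ω ≤
      G ω * (randCondMutualInfo P (R.inst s) (R.obs s t) (R.hist n s t) ω) ^ (1 / 2 : ℝ) + ε ω)
    {c : ℝ≥0} (hc : ∀ᵐ ω ∂P, G ω ≤ c) :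
    ∫⁻ ω, ENNReal.ofReal (R.gap E s t ω) ∂P ≤
      c * (condMutualInfo P (R.inst s) (R.obs s t) (R.hist n s t)) ^ (1 / 2 : ℝ)
        + ∫⁻ ω, ε ω ∂P := by
  have hH := R.measurable_hist n s t
  calc ∫⁻ ω, ENNReal.ofReal (R.gap E s t ω) ∂P
      = ∫⁻ ω, R.condGap E P n s t ω ∂P := (lintegral_condLExp hH.comap_le P _).symm
    _ ≤ ∫⁻ ω, (c * (randCondMutualInfo P (R.inst s) (R.obs s t) (R.hist n s t) ω) ^ (1 / 2 : ℝ)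
          + ε ω) ∂P := by
        -- Passing to the constant `c` before integrating lets it leave the integral, so that Jensen
        -- applies to the root alone.
        refine lintegral_mono_ae ?_
        filter_upwards [hgap, hc] with ω h1 h2
        exact h1.trans (by gcongr)
    _ = c * ∫⁻ ω, (randCondMutualInfo P (R.inst s) (R.obs s t) (R.hist n s t) ω) ^ (1 / 2 : ℝ) ∂P
          + ∫⁻ ω, ε ω ∂P := by
        rw [lintegral_add_right _ (by fun_prop), lintegral_const_mul' _ _ ENNReal.coe_ne_top]
    _ ≤ _ := by
        gcongr
        exact lintegral_rpow_half_le P (measurable_randCondMutualInfo P _ _ hH).aemeasurable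

end BanditRun

/-! ### Assembly of the regret bound. -/

theorem lemma1 {Ω M Θ 𝒜 : Type*} [MeasurableSpace Ω]
    [MeasurableSpace M] [StandardBorelSpace M] [Nonempty M]
    [MeasurableSpace Θ] [StandardBorelSpace Θ] [Nonempty Θ]
    [MeasurableSpace 𝒜] [DiscreteMeasurableSpace 𝒜] [Finite 𝒜] [Nonempty 𝒜]
    (P : Measure Ω) [IsProbabilityMeasure P] (E : BanditEnv M Θ 𝒜) (R : BanditRun Ω M Θ 𝒜)
    (m n : ℕ) (hR : R.IsInteraction E P m n)
    (Γst ε : ℕ → ℕ → Ω → ℝ≥0)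
    (hΓst : ∀ s < m, ∀ t < n, Measurable (Γst s t))
    (hε : ∀ s < m, ∀ t < n, Measurable (ε s t))
    (hgap : ∀ s < m, ∀ t < n, ∀ᵐ ω ∂P,
      R.condGap E P n s t ω ≤
        Γst s t ω * (randCondMutualInfo P (R.inst s) (R.obs s t) (R.hist n s t) ω) ^ (1 / 2 : ℝ)
          + ε s t ω)
    (Γs : ℕ → ℝ≥0) (Γ : ℝ≥0)
    (hΓs : ∀ s < m, ∀ t < n, ∀ᵐ ω ∂P, Γst s t ω ≤ Γs s)
    (hΓ : ∀ s < m, Γs s ≤ Γ) :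
    R.bayesRegret E P m n ≤
      Γ * (m * n * mutualInfo P R.metaParam (R.pastHist n m)) ^ (1 / 2 : ℝ)
      + ∑ s ∈ Finset.range m,
          Γs s * (n * condMutualInfo P (R.inst s) (R.taskHist s n)
            (fun ω => (R.metaParam ω, R.pastHist n s ω))) ^ (1 / 2 : ℝ)
      + ∑ s ∈ Finset.range m, ∑ t ∈ Finset.range n, ∫⁻ ω, ε s t ω ∂P := by
  let a : ℕ → ℕ → ℝ≥0∞ := fun s t => condMutualInfo P R.metaParam (R.obs s t) (R.hist n s t)
  let b : ℕ → ℕ → ℝ≥0∞ := fun s t => condMutualInfo P (R.inst s) (R.obs s t)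
    (fun ω => (R.hist n s t ω, R.metaParam ω))
  have hround : ∀ s < m, ∀ t < n, ∫⁻ ω, ENNReal.ofReal (R.gap E s t ω) ∂P ≤
      Γ * a s t ^ (1 / 2 : ℝ) + Γs s * b s t ^ (1 / 2 : ℝ) + ∫⁻ ω, ε s t ω ∂P := by
    intro s hs t ht
    refine (R.lintegral_gap_le P (hε s hs t ht) (hgap s hs t ht) (hΓs s hs t ht)).trans ?_
    gcongr
    calc (Γs s : ℝ≥0∞) * condMutualInfo P (R.inst s) (R.obs s t) (R.hist n s t) ^ (1 / 2 : ℝ)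
        ≤ Γs s * (a s t + b s t) ^ (1 / 2 : ℝ) := by
          gcongr
          exact condMutualInfo_le_add (R.measurable_inst s) R.measurable_metaParam
            (R.measurable_obs s t) (R.measurable_hist n s t)
      _ ≤ Γs s * (a s t ^ (1 / 2 : ℝ) + b s t ^ (1 / 2 : ℝ)) := by
          gcongr
          exact ENNReal.rpow_add_le_add_rpow _ _ (by norm_num) (by norm_num)
      _ ≤ Γ * a s t ^ (1 / 2 : ℝ) + Γs s * b s t ^ (1 / 2 : ℝ) := by
          -- Only the `μ_*` part is weakened to the uniform `Γ`: its Cauchy–Schwarz runs across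
          -- tasks, while the other stays within one task and keeps `Γs s`.
          rw [mul_add]
          gcongr
          exact hΓ s hs
  have ha : ∑ s ∈ Finset.range m, ∑ t ∈ Finset.range n, a s t ^ (1 / 2 : ℝ) ≤
      (m * n * mutualInfo P R.metaParam (R.pastHist n m)) ^ (1 / 2 : ℝ) := by
    -- The double sum becomes one sum over `mn` pairs, so a single Cauchy–Schwarz yields the factor
    -- `mn`.
    rw [← Finset.sum_product']
    refine (ENNReal.sum_rpow_half_le _ _).trans ?_
    rw [Finset.sum_product]
    simp only [Finset.card_product, Finset.card_range, Nat.cast_mul]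
    gcongr
    exact R.sum_condMutualInfo_hist_le P R.measurable_metaParam m n
  have hb : ∀ s, ∑ t ∈ Finset.range n, b s t ^ (1 / 2 : ℝ) ≤
      (n * condMutualInfo P (R.inst s) (R.taskHist s n)
        (fun ω => (R.metaParam ω, R.pastHist n s ω))) ^ (1 / 2 : ℝ) := by
    intro s
    refine (ENNReal.sum_rpow_half_le _ _).trans ?_
    rw [Finset.card_range]
    gcongr
    exact R.sum_condMutualInfo_inst_le P s n
  rw [R.bayesRegret_eq_sum]
  refine (Finset.sum_le_sum fun s hs => Finset.sum_le_sum fun t ht =>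
    hround s (Finset.mem_range.1 hs) t (Finset.mem_range.1 ht)).trans ?_
  simp only [Finset.sum_add_distrib, ← Finset.mul_sum]
  gcongr with s hs
  exact hb s
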